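/- Let $(M,g)$ be a finite-dimensional smooth Riemannian manifold (without boundary), let $\zeta$ be a vector field on $M$, let $I\subseteq\mathbb{R}$ be an open interval with coordinate $t$, and let $h:I\to\mathbb{R}$ be a smooth function with derivative $\dot h$. For functions $f:M\to(0,\infty)$ and $\sigma:I\to(0,\infty)$ let $\bar M={}_{f}I\times_{\sigma}M$ be the doubly warped space-time, i.e. the product manifold $I\times M$ with the metric $\bar g=-f^{2}\,dt^{2}\oplus\sigma^{2}g$, and let $\bar\zeta=h\,\partial_t+\zeta$. A quadruple $(N,k,\xi,\lambda)$, consisting of a smooth manifold $N$ with a pseudo-Riemannian metric $k$, a smooth vector field $\xi$ on $N$ and a constant $\lambda\in\mathbb{R}$, is called a Ricci soliton if $$\tfrac12(\mathcal{L}_{\xi}k)(X,Y)+\mathrm{Ric}(X,Y)=\lambda\,k(X,Y)\qquad\text{for all tangent vectors } X,Y,$$ where $\mathcal{L}_\xi$ is the Lie derivative and $\mathrm{Ric}$ is the Ricci tensor of $k$. Suppose that $f=\sigma=1$, that $\dot h=\lambda$ is constant on $I$, and that $(M,g,\zeta,\lambda)$ is a Ricci soliton. Then $(\bar M,\bar g,\bar\zeta,\lambda)$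 is a Ricci soliton. -/

import Mathlib

open scoped Manifold ContDiff

noncomputable section

/-! ### Pseudo-Riemannian calculus on a finite-dimensional vector space

`G` is a field of bilinear forms on `E`, thought of as the components of a metric in a chart, and
`y : E` is the point at which everything is evaluated. -/

section Local

variable {E : Type*} [NormedAddCommGroup E] [NormedSpace ℝ E]

/-- Christoffel symbols, i.e. `Γ(u, v) = ∇_u v` for constant fields `u`, `v`, where `∇` is the
Levi-Civita connection of `G`: the vector `Γ(u, v)` is obtained from the covector
`w ↦ (1/2) (∂_u G(v, w) + ∂_v G(u, w) - ∂_w G(u, v))` by raising the index, that is by applying the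
inverse of `x ↦ G(x, ·)`. See `christoffel_spec`. -/
def christoffel (G : E → E →L[ℝ] E →L[ℝ] ℝ) (y : E) : E →L[ℝ] E →L[ℝ] E :=
  let D : E →L[ℝ] E →L[ℝ] E →L[ℝ] ℝ := fderiv ℝ G y
  let F : (E →L[ℝ] E →L[ℝ] ℝ) →L[ℝ] E →L[ℝ] E →L[ℝ] ℝ :=
    (ContinuousLinearMap.flipₗᵢ ℝ E E ℝ).toContinuousLinearEquiv.toContinuousLinearMap
  let raise : (E →L[ℝ] E →L[ℝ] ℝ) →L[ℝ] E →L[ℝ] E :=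
    ContinuousLinearMap.compL ℝ E (E →L[ℝ] ℝ) E (G y).inverse
  (2⁻¹ : ℝ) • (raise ∘L D + raise ∘L D.flip - raise ∘L F ∘L D.flip)

theorem christoffel_spec (G : E → E →L[ℝ] E →L[ℝ] ℝ) (y : E) (hG : (G y).IsInvertible)
    (u v w : E) :
    G y (christoffel G y u v) w =
      2⁻¹ * (fderiv ℝ G y u v w + fderiv ℝ G y v u w - fderiv ℝ G y w u v) := by
  obtain ⟨e, he⟩ := hG
  have key : ∀ α : E →L[ℝ] ℝ, G y ((G y).inverse α) = α := by
    intro α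
    rw [← he, ContinuousLinearMap.inverse_equiv]
    exact e.apply_symm_apply α
  simp [christoffel, key]

/-- The Riemann curvature `R(u, v) w = ∇_u ∇_v w - ∇_v ∇_u w` for constant fields `u`, `v`, `w`. -/
def localCurvature (G : E → E →L[ℝ] E →L[ℝ] ℝ) (y u v w : E) : E :=
  fderiv ℝ (christoffel G) y u v w - fderiv ℝ (christoffel G) y v u w +
    christoffel G y u (christoffel G y v w) - christoffel G y v (christoffel G y u w)

/-- The Ricci curvature `Ric(v, w) = trace (u ↦ R(u, v) w)`. -/
def localRicci (G : E → E →L[ℝ] E →L[ℝ] ℝ) (y v w : E) : ℝ :=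
  LinearMap.trace ℝ E
    { toFun := fun u => localCurvature G y u v w
      map_add' := fun a b => by simp [localCurvature]; abel
      map_smul' := fun c a => by simp [localCurvature, smul_sub, smul_add] }

/-- The Lie derivative of `G` along the vector field `Z`:
`(L_Z G)(u, v) = (∂_Z G)(u, v) + G(∂_u Z, v) + G(u, ∂_v Z)`. -/
def localLieDerivative (G : E → E →L[ℝ] E →L[ℝ] ℝ) (Z : E → E) (y u v : E) : ℝ :=
  fderiv ℝ G y (Z y) u v + G y (fderiv ℝ Z y u) v + G y u (fderiv ℝ Z y v)

end Local

/-! ### Tensors on manifolds (without boundary) -/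

section Manifold

variable {E : Type*} [NormedAddCommGroup E] [NormedSpace ℝ E]
  {H : Type*} [TopologicalSpace H] (I : ModelWithCorners ℝ E H)
  {M : Type*} [TopologicalSpace M] [ChartedSpace H M]
  {E' : Type*} [NormedAddCommGroup E'] [NormedSpace ℝ E']
  {H' : Type*} [TopologicalSpace H'] (I' : ModelWithCorners ℝ E' H')
  {M' : Type*} [TopologicalSpace M'] [ChartedSpace H' M']

variable (M) in
/-- Fields of bilinear forms on the tangent spaces of `M`, i.e. covariant `2`-tensor fields. -/
abbrev TwoTensor : Type _ :=
  ∀ x : M, TangentSpace I x →L[ℝ] TangentSpace I x →L[ℝ] ℝ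

/-- The pullback `φ^* g`, with `(φ^* g)_x (u, v) = g_{φ x} (dφ_x u, dφ_x v)`. -/
def TwoTensor.pullback (φ : M → M') (g : TwoTensor I' M') : TwoTensor I M := fun x =>
  ContinuousLinearMap.precomp ℝ (mfderiv I I' φ x) ∘L g (φ x) ∘L mfderiv I I' φ x

theorem TwoTensor.pullback_apply (φ : M → M') (g : TwoTensor I' M') (x : M)
    (u v : TangentSpace I x) :
    TwoTensor.pullback I I' φ g x u v = g (φ x) (mfderiv I I' φ x u) (mfderiv I I' φ x v) := rfl

/-- A smooth symmetric nondegenerate covariant `2`-tensor field. -/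
structure IsPseudoRiemannianMetric [IsManifold I 1 M] (g : TwoTensor I M) : Prop where
  symm : ∀ (x : M) (u v : TangentSpace I x), g x u v = g x v u
  nondegenerate : ∀ (x : M) (u : TangentSpace I x), (∀ v, g x u v = 0) → u = 0
  smooth : ContMDiff I (I.prod 𝓘(ℝ, E →L[ℝ] E →L[ℝ] ℝ)) ∞
    (fun x => Bundle.TotalSpace.mk' (E →L[ℝ] E →L[ℝ] ℝ)
      (E := fun x : M => TangentSpace I x →L[ℝ] TangentSpace I x →L[ℝ] ℝ) x (g x))

/-- A smooth vector field on `M`. -/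
def IsSmoothVectorField [IsManifold I 1 M] (ζ : ∀ x : M, TangentSpace I x) : Prop :=
  ContMDiff I I.tangent ∞ (fun x => (⟨x, ζ x⟩ : TangentBundle I M))

/-- The components of `g` in the chart around `x₀`: the pullback of `g` by the inverse chart. -/
def chartTensor (g : TwoTensor I M) (x₀ : M) : E → E →L[ℝ] E →L[ℝ] ℝ :=
  TwoTensor.pullback 𝓘(ℝ, E) I (extChartAt I x₀).symm g

/-- The components of `ζ` in the chart around `x₀`: the pullback of `ζ` by the inverse chart. -/
def chartVectorField (ζ : ∀ x : M, TangentSpace I x) (x₀ : M) : E → E :=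
  VectorField.mpullback 𝓘(ℝ, E) I (extChartAt I x₀).symm ζ

/-- The Ricci tensor of the pseudo-Riemannian metric `g` at `x`, computed in the chart around
`x`. -/
def ricciTensor (g : TwoTensor I M) (x : M) (u v : TangentSpace I x) : ℝ :=
  localRicci (chartTensor I g x) (extChartAt I x x)
    (mfderiv I 𝓘(ℝ, E) (extChartAt I x) x u) (mfderiv I 𝓘(ℝ, E) (extChartAt I x) x v)

/-- The Lie derivative `L_ζ g` at `x`, computed in the chart around `x`. -/
def lieDerivativeTensor (ζ : ∀ x : M, TangentSpace I x) (g : TwoTensor I M) (x : M)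
    (u v : TangentSpace I x) : ℝ :=
  localLieDerivative (chartTensor I g x) (chartVectorField I ζ x) (extChartAt I x x)
    (mfderiv I 𝓘(ℝ, E) (extChartAt I x) x u) (mfderiv I 𝓘(ℝ, E) (extChartAt I x) x v)

/-- `(M, g, ζ, c)` is a Ricci soliton: `g` is a pseudo-Riemannian metric, `ζ` is a smooth vector
field, `c` is a constant, and `(1/2) L_ζ g + Ric = c g`. -/
structure IsRicciSoliton [IsManifold I 1 M] (g : TwoTensor I M)
    (ζ : ∀ x : M, TangentSpace I x) (c : ℝ) : Prop where
  metric : IsPseudoRiemannianMetric I g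
  field : IsSmoothVectorField I ζ
  equation : ∀ (x : M) (u v : TangentSpace I x),
    (1 / 2 : ℝ) * lieDerivativeTensor I ζ g x u v + ricciTensor I g x u v = c * g x u v

/-- The doubly warped product metric `(f₂ ∘ π₂)² π₁^* g₁ ⊕ (f₁ ∘ π₁)² π₂^* g₂` on `M × M'`. -/
def doublyWarpedMetric (f₂ : M' → ℝ) (g₁ : TwoTensor I M) (f₁ : M → ℝ) (g₂ : TwoTensor I' M') :
    TwoTensor (I.prod I') (M × M') := fun p =>
  (f₂ p.2) ^ 2 • TwoTensor.pullback (I.prod I') I Prod.fst g₁ p +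
    (f₁ p.1) ^ 2 • TwoTensor.pullback (I.prod I') I' Prod.snd g₂ p

end Manifold

/-! ### Doubly warped space-times

`J` is an open interval of the real line, regarded as a one-dimensional manifold. -/

section SpaceTime

open TopologicalSpace

variable {J : Opens ℝ}

/-- The `1`-form `dt` on `J`: the differential of the inclusion of `J` into the real line. -/
def dt (t : J) : TangentSpace 𝓘(ℝ, ℝ) t →L[ℝ] ℝ :=
  mfderiv 𝓘(ℝ, ℝ) 𝓘(ℝ, ℝ) (Subtype.val : J → ℝ) t

/-- The metric `-dt²` on `J`. -/
def negDtSq (J : Opens ℝ) : TwoTensor 𝓘(ℝ, ℝ) J := fun t =>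
  -(dt t).smulRight (dt t)

/-- The coordinate vector field `∂_t` on `J`. -/
def partialT (t : J) : TangentSpace 𝓘(ℝ, ℝ) t := (1 : ℝ)

theorem dt_eq_id (t : J) : dt t = ContinuousLinearMap.id ℝ ℝ := by
  have : HasMFDerivAt 𝓘(ℝ, ℝ) 𝓘(ℝ, ℝ) (Subtype.val : J → ℝ) t (ContinuousLinearMap.id ℝ ℝ) := by
    refine ⟨continuous_subtype_val.continuousAt, ?_⟩
    refine HasFDerivWithinAt.congr_of_eventuallyEq (hasFDerivWithinAt_id _ _) ?_ ?_
    · filter_upwards [extChartAt_target_mem_nhdsWithin (I := 𝓘(ℝ, ℝ)) t] with y hy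
      exact (extChartAt 𝓘(ℝ, ℝ) t).right_inv hy
    · exact (extChartAt 𝓘(ℝ, ℝ) t).right_inv (mem_extChartAt_target t)
  exact this.mfderiv

theorem dt_smul_partialT (t : J) (a : ℝ) : dt t (a • partialT t) = a := by
  rw [dt_eq_id]
  exact mul_one a

/-- The derivative `ḣ = ∂_t h` of a function `h` on `J`. -/
def timeDeriv (h : J → ℝ) (t : J) : ℝ := mfderiv 𝓘(ℝ, ℝ) 𝓘(ℝ, ℝ) h t (partialT t)

variable {E : Type*} [NormedAddCommGroup E] [NormedSpace ℝ E]
  {H : Type*} [TopologicalSpace H] (I : ModelWithCorners ℝ E H)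
  {M : Type*} [TopologicalSpace M] [ChartedSpace H M]

/-- The metric `-f² dt² ⊕ σ² g` of the doubly warped space-time. -/
def spaceTimeMetric (f : M → ℝ) (σ : J → ℝ) (g : TwoTensor I M) :
    TwoTensor (𝓘(ℝ, ℝ).prod I) (J × M) :=
  doublyWarpedMetric 𝓘(ℝ, ℝ) I f (negDtSq J) σ g

theorem spaceTimeMetric_apply (f : M → ℝ) (σ : J → ℝ) (g : TwoTensor I M) (p : J × M)
    (x y : ℝ) (X Y : TangentSpace I p.2) :
    spaceTimeMetric I f σ g p (x • partialT p.1, X) (y • partialT p.1, Y) =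
      -x * y * (f p.2) ^ 2 + (σ p.1) ^ 2 * g p.2 X Y := by
  have e1 := mfderiv_fst (𝕜 := ℝ) (I := 𝓘(ℝ, ℝ)) (I' := I) (x := p)
  have e2 := mfderiv_snd (𝕜 := ℝ) (I := 𝓘(ℝ, ℝ)) (I' := I) (x := p)
  change (f p.2) ^ 2 * negDtSq J p.1 (mfderiv (𝓘(ℝ, ℝ).prod I) 𝓘(ℝ, ℝ) Prod.fst p _)
      (mfderiv (𝓘(ℝ, ℝ).prod I) 𝓘(ℝ, ℝ) Prod.fst p _) +
    (σ p.1) ^ 2 * g p.2 (mfderiv (𝓘(ℝ, ℝ).prod I) I Prod.snd p _)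
      (mfderiv (𝓘(ℝ, ℝ).prod I) I Prod.snd p _) = _
  rw [e1, e2]
  change (f p.2) ^ 2 * (-(dt p.1 (x • partialT p.1) * dt p.1 (y • partialT p.1))) +
    (σ p.1) ^ 2 * g p.2 X Y = _
  rw [dt_smul_partialT, dt_smul_partialT]
  ring

/-- The vector field `h ∂_t + ζ` on `J × M`, whose components under the identification
`T_{(t, x)} (J × M) = T_t J × T_x M` are `h(t) ∂_t` and `ζ(x)`. -/
def liftedField (h : J → ℝ) (ζ : ∀ x : M, TangentSpace I x) :
    ∀ p : J × M, TangentSpace (𝓘(ℝ, ℝ).prod I) p :=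
  fun p => (h p.1 • partialT p.1, ζ p.2)

end SpaceTime

end

/-! When `f = σ = 1` the metric is the product `-dt² ⊕ g`. In a product chart its components are
`lorentzForm (G z.2)`: block diagonal, with constant time block and a block `G` independent of time.
Hence every Christoffel symbol with a time index vanishes, curvature takes values in the
`M`-directions, and Ricci is the pullback of that of `g` (`localRicci_lorentzForm`). The Lie
derivative splits as `-2ḣ dt² ⊕ L_ζ g` (`localLieDerivative_lorentzForm`), so `½ L + Ric = -ḣ dt² +
(½ L_ζ g + Ric_g) = c (-dt² + g)`. The lemmas `chartTensor_spaceTimeMetric` and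
`chartVectorField_liftedField` carry this from charts to the manifold. -/

/-! ### Derivatives through split linear maps. -/

section SplitLinear

variable {E F X Y V W : Type*} [NormedAddCommGroup E] [NormedSpace ℝ E]
  [NormedAddCommGroup F] [NormedSpace ℝ F] [NormedAddCommGroup X] [NormedSpace ℝ X]
  [NormedAddCommGroup Y] [NormedSpace ℝ Y] [NormedAddCommGroup V] [NormedSpace ℝ V]
  [NormedAddCommGroup W] [NormedSpace ℝ W]

/-- The chain rule for pre- and postcomposition with split linear maps; no differentiability
assumption is needed. -/
theorem fderiv_splitLinear_comp (L : V →L[ℝ] W) (R : W →L[ℝ] V) (hRL : ∀ a, R (L a) = a)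
    (q : X →L[ℝ] E) (r : E →L[ℝ] X) (hqr : ∀ a, q (r a) = a) (f : E → V) (x : X) :
    fderiv ℝ (fun z => L (f (q z))) x = L ∘L fderiv ℝ f (q x) ∘L q := by
  by_cases hf : DifferentiableAt ℝ f (q x)
  · have h1 : HasFDerivAt (fun z => f (q z)) (fderiv ℝ f (q x) ∘L q) x :=
      hf.hasFDerivAt.comp x q.hasFDerivAt
    exact (L.hasFDerivAt.comp x h1).fderiv
  · rw [fderiv_zero_of_not_differentiableAt hf, fderiv_zero_of_not_differentiableAt]
    · simp
    · intro hd
      apply hf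
      -- The affine section `e ↦ x + r (e - q x)` of `q` passes through `x`, which need not lie in
      -- the range of `r`. Composing with it and with `R` recovers `f`, so both sides fail to be
      -- differentiable together and both default derivatives are zero.
      have hx : x + r (q x - q x) = x := by simp
      rw [← hx] at hd
      have h1 : DifferentiableAt ℝ (fun e : E => x + r (e - q x)) (q x) := by fun_prop
      have h2 := (R.differentiableAt.comp _ hd).comp (q x) h1
      have h3 : (R ∘ fun z => L (f (q z))) ∘ (fun e : E => x + r (e - q x)) = f := by
        funext e
        simp [hRL, hqr]
      rwa [h3] at h2

/-- The bilinear map `(u, v) ↦ ι (B (q u) (q v))`, as a function of the bilinear map `B`. -/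
noncomputable def bilinearTransport (q : X →L[ℝ] E) (ι : F →L[ℝ] Y) :
    (E →L[ℝ] E →L[ℝ] F) →L[ℝ] X →L[ℝ] X →L[ℝ] Y :=
  ContinuousLinearMap.precomp (X →L[ℝ] Y) q ∘L
    ContinuousLinearMap.postcomp E
      (ContinuousLinearMap.postcomp X ι ∘L ContinuousLinearMap.precomp F q)

@[simp] theorem bilinearTransport_apply (q : X →L[ℝ] E) (ι : F →L[ℝ] Y)
    (B : E →L[ℝ] E →L[ℝ] F) (u v : X) :
    bilinearTransport q ι B u v = ι (B (q u) (q v)) := rfl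

theorem bilinearTransport_leftInverse (q : X →L[ℝ] E) (r : E →L[ℝ] X) (hqr : ∀ a, q (r a) = a)
    (ι : F →L[ℝ] Y) (ρ : Y →L[ℝ] F) (hρι : ∀ a, ρ (ι a) = a) (B : E →L[ℝ] E →L[ℝ] F) :
    bilinearTransport r ρ (bilinearTransport q ι B) = B := by
  ext u v
  simp [hqr, hρι]

theorem fderiv_bilinearTransport (q : X →L[ℝ] E) (r : E →L[ℝ] X) (hqr : ∀ a, q (r a) = a)
    (ι : F →L[ℝ] Y) (ρ : Y →L[ℝ] F) (hρι : ∀ a, ρ (ι a) = a) (G : E → E →L[ℝ] E →L[ℝ] F)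
    (x u v w : X) :
    fderiv ℝ (fun z => bilinearTransport q ι (G (q z))) x u v w =
      ι (fderiv ℝ G (q x) (q u) (q v) (q w)) := by
  have h := bilinearTransport_leftInverse q r hqr ι ρ hρι
  have h2 := fderiv_splitLinear_comp (V := E →L[ℝ] E →L[ℝ] F) (W := X →L[ℝ] X →L[ℝ] Y)
    (bilinearTransport q ι) (bilinearTransport r ρ) h q r hqr G x
  exact congrArg (fun T => T u v w) h2

end SplitLinear

/-! ### Local geometry of `-ds² ⊕ G` on `ℝ × E`. -/

section TimeProduct

open ContinuousLinearMap Filter Topology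

variable {E : Type*} [NormedAddCommGroup E] [NormedSpace ℝ E]

/-- The bilinear form `-ds² ⊕ A` on `ℝ × E`. -/
noncomputable def lorentzForm (A : E →L[ℝ] E →L[ℝ] ℝ) : (ℝ × E) →L[ℝ] (ℝ × E) →L[ℝ] ℝ :=
  -(fst ℝ ℝ E).smulRight (fst ℝ ℝ E) +
    bilinearTransport (snd ℝ ℝ E) (ContinuousLinearMap.id ℝ ℝ) A

@[simp] theorem lorentzForm_apply (A : E →L[ℝ] E →L[ℝ] ℝ) (u v : ℝ × E) :
    lorentzForm A u v = -(u.1 * v.1) + A u.2 v.2 := by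
  simp [lorentzForm]

theorem fderiv_lorentzForm (G : E → E →L[ℝ] E →L[ℝ] ℝ) (p u v w : ℝ × E) :
    fderiv ℝ (fun z : ℝ × E => lorentzForm (G z.2)) p u v w = fderiv ℝ G p.2 u.2 v.2 w.2 := by
  have h := fderiv_bilinearTransport (snd ℝ ℝ E) (inr ℝ ℝ E) (fun _ => rfl)
    (ContinuousLinearMap.id ℝ ℝ) (ContinuousLinearMap.id ℝ ℝ) (fun _ => rfl) G p u v w
  have h2 := fderiv_const_add (𝕜 := ℝ) (x := p) (f := fun z : ℝ × E => bilinearTransport (snd ℝ ℝ E)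
    (ContinuousLinearMap.id ℝ ℝ) (G z.2)) (-(fst ℝ ℝ E).smulRight (fst ℝ ℝ E))
  exact (congrArg (fun T => T u v w) h2).trans h

/-- Raising an index of a covector without time component. No nondegeneracy is required: `A` and
`lorentzForm A` are invertible together, and `inverse` is zero otherwise. -/
theorem lorentzForm_inverse_apply (A : E →L[ℝ] E →L[ℝ] ℝ) (β : E →L[ℝ] ℝ) :
    (lorentzForm A).inverse (β ∘L snd ℝ ℝ E) = inr ℝ ℝ E (A.inverse β) := by
  by_cases hA : A.IsInvertible
  · obtain ⟨e, rfl⟩ := hA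
    -- The sign of the time component comes from `-ds²`.
    let g : ((ℝ × E) →L[ℝ] ℝ) →L[ℝ] ℝ × E :=
      (-(ContinuousLinearMap.apply ℝ ℝ ((1 : ℝ), (0 : E)))).prod
        ((e.symm : (E →L[ℝ] ℝ) →L[ℝ] E) ∘L precomp ℝ (inr ℝ ℝ E))
    have hinv : (lorentzForm (e : E →L[ℝ] E →L[ℝ] ℝ)).IsInvertible := by
      refine IsInvertible.of_inverse (g := g) ?_ ?_
      · refine ContinuousLinearMap.ext fun γ => ContinuousLinearMap.ext fun w => ?_
        have hw : w = w.1 • ((1 : ℝ), (0 : E)) + (0, w.2) := by ext <;> simp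
        conv_rhs => rw [hw, map_add, map_smul]
        simp [g, mul_comm]
      · refine ContinuousLinearMap.ext fun w => Prod.ext ?_ ?_
        · simp [g]
        · have h : (lorentzForm (e : E →L[ℝ] E →L[ℝ] ℝ) w) ∘L inr ℝ ℝ E = e w.2 := by
            ext v
            simp
          simp [g, h]
    rw [hinv.inverse_apply_eq]
    ext w <;> simp
  · have hA' : ¬ (lorentzForm A).IsInvertible := by
      rintro ⟨e, he⟩
      apply hA
      refine IsInvertible.of_inverse (g := snd ℝ ℝ E ∘L
        (e.symm : ((ℝ × E) →L[ℝ] ℝ) →L[ℝ] ℝ × E) ∘L precomp ℝ (snd ℝ ℝ E)) ?_ ?_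
      · ext β w
        have h := e.apply_symm_apply (β ∘L snd ℝ ℝ E)
        have h' := congrArg (fun L => L ((0 : ℝ), w)) h
        rw [← ContinuousLinearEquiv.coe_coe, he] at h'
        simpa using h'
      · ext v
        have h : (A v) ∘L snd ℝ ℝ E = e (0, v) := by
          rw [← ContinuousLinearEquiv.coe_coe, he]
          ext w <;> simp
        simp [precomp_apply, h]
    rw [inverse_of_not_isInvertible hA, inverse_of_not_isInvertible hA']
    exact (map_zero (inr ℝ ℝ E)).symm

/-- The time block is constant, so the covectors being raised all factor through `snd`, and
`lorentzForm_inverse_apply` applies to each. -/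
theorem christoffel_lorentzForm (G : E → E →L[ℝ] E →L[ℝ] ℝ) (p : ℝ × E) :
    christoffel (fun z : ℝ × E => lorentzForm (G z.2)) p =
      bilinearTransport (snd ℝ ℝ E) (inr ℝ ℝ E) (christoffel G p.2) := by
  set D := fderiv ℝ (fun z : ℝ × E => lorentzForm (G z.2)) p with hD
  have h1 : ∀ u v : ℝ × E, D u v = (fderiv ℝ G p.2 u.2 v.2) ∘L snd ℝ ℝ E := by
    intro u v
    ext w <;> simp [hD, fderiv_lorentzForm]
  have h2 : ∀ u v : ℝ × E, (flipₗᵢ ℝ (ℝ × E) (ℝ × E) ℝ (D.flip u)) v =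
      (flipₗᵢ ℝ E E ℝ ((fderiv ℝ G p.2).flip u.2)) v.2 ∘L snd ℝ ℝ E := by
    intro u v
    ext w <;> simp [hD, fderiv_lorentzForm]
  refine ContinuousLinearMap.ext fun u => ContinuousLinearMap.ext fun v => ?_
  have h1' := h1 v u
  have h2' := h2 u v
  have h1 := h1 u v
  simp only [christoffel, ← hD, bilinearTransport_apply, smul_apply, add_apply, sub_apply,
    comp_apply, compL_apply, flip_apply, ContinuousLinearEquiv.coe_coe,
    LinearIsometryEquiv.coe_toContinuousLinearEquiv] at h1' h2' ⊢
  rw [h1, h1', h2']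
  simp only [lorentzForm_inverse_apply, map_smul, map_add, map_sub, coe_snd']

theorem localCurvature_lorentzForm (G : E → E →L[ℝ] E →L[ℝ] ℝ) (p u v w : ℝ × E) :
    localCurvature (fun z : ℝ × E => lorentzForm (G z.2)) p u v w =
      inr ℝ ℝ E (localCurvature G p.2 u.2 v.2 w.2) := by
  have hc : christoffel (fun z : ℝ × E => lorentzForm (G z.2)) = fun z : ℝ × E =>
      bilinearTransport (snd ℝ ℝ E) (inr ℝ ℝ E) (christoffel G (snd ℝ ℝ E z)) :=
    funext (christoffel_lorentzForm G)
  have h := fderiv_bilinearTransport (snd ℝ ℝ E) (inr ℝ ℝ E) (fun _ => rfl)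
    (inr ℝ ℝ E) (snd ℝ ℝ E) (fun _ => rfl) (christoffel G) p
  rw [localCurvature, hc, h, h]
  simp [localCurvature]

/-- The curvature endomorphism is `inr ∘ T ∘ snd`; cyclicity of the trace and `snd ∘ inr = id` leave
`trace T`. -/
theorem localRicci_lorentzForm [FiniteDimensional ℝ E] (G : E → E →L[ℝ] E →L[ℝ] ℝ)
    (p v w : ℝ × E) :
    localRicci (fun z : ℝ × E => lorentzForm (G z.2)) p v w = localRicci G p.2 v.2 w.2 := by
  unfold localRicci
  set T : E →ₗ[ℝ] E := _
  set T' : ℝ × E →ₗ[ℝ] ℝ × E := _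
  change LinearMap.trace ℝ (ℝ × E) T' = LinearMap.trace ℝ E T
  have h : T' = LinearMap.inr ℝ ℝ E ∘ₗ (T ∘ₗ LinearMap.snd ℝ ℝ E) :=
    LinearMap.ext fun u => localCurvature_lorentzForm G p u v w
  rw [h, LinearMap.trace_comp_comm']
  congr 1

theorem localLieDerivative_lorentzForm (G : E → E →L[ℝ] E →L[ℝ] ℝ) (Z : E → E) (k : ℝ → ℝ)
    (p u v : ℝ × E) (hZ : DifferentiableAt ℝ Z p.2) (hk : DifferentiableAt ℝ k p.1) :
    localLieDerivative (fun z : ℝ × E => lorentzForm (G z.2)) (fun z => (k z.1, Z z.2)) p u v =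
      -(2 * deriv k p.1 * u.1 * v.1) + localLieDerivative G Z p.2 u.2 v.2 := by
  have hd : fderiv ℝ (fun z : ℝ × E => (k z.1, Z z.2)) p =
      (fderiv ℝ k p.1 ∘L fst ℝ ℝ E).prod (fderiv ℝ Z p.2 ∘L snd ℝ ℝ E) :=
    ((hk.hasFDerivAt.comp p hasFDerivAt_fst).prodMk
      (hZ.hasFDerivAt.comp p hasFDerivAt_snd)).fderiv
  simp only [localLieDerivative, fderiv_lorentzForm, hd]
  simp [fderiv_eq_smul_deriv]
  ring

theorem christoffel_congr {G G' : E → E →L[ℝ] E →L[ℝ] ℝ} {y : E} (h : G =ᶠ[𝓝 y] G') :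
    christoffel G y = christoffel G' y := by
  simp only [christoffel, h.fderiv_eq, h.eq_of_nhds]

/-- Curvature differentiates the Christoffel symbols, so these must agree on a neighbourhood, not
only at `y`. -/
theorem localRicci_congr {G G' : E → E →L[ℝ] E →L[ℝ] ℝ} {y : E} (h : G =ᶠ[𝓝 y] G') (v w : E) :
    localRicci G y v w = localRicci G' y v w := by
  have h' : christoffel G =ᶠ[𝓝 y] christoffel G' :=
    h.eventuallyEq_nhds.mono fun z hz => christoffel_congr hz
  simp only [localRicci, localCurvature, h'.fderiv_eq, h'.eq_of_nhds]

theorem localLieDerivative_congr {G G' : E → E →L[ℝ] E →L[ℝ] ℝ} {Z Z' : E → E} {y : E}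
    (h : G =ᶠ[𝓝 y] G') (hZ : Z =ᶠ[𝓝 y] Z') (v w : E) :
    localLieDerivative G Z y v w = localLieDerivative G' Z' y v w := by
  simp only [localLieDerivative, h.fderiv_eq, h.eq_of_nhds, hZ.fderiv_eq, hZ.eq_of_nhds]

end TimeProduct

/-! ### Tensors and vector fields in charts. -/

section ChartComponents

open Filter Topology

variable {E : Type*} [NormedAddCommGroup E] [NormedSpace ℝ E]
  {H : Type*} [TopologicalSpace H] {I : ModelWithCorners ℝ E H}
  {M : Type*} [TopologicalSpace M] [ChartedSpace H M] [IsManifold I 1 M]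

theorem ricciTensor_eq_localRicci (g : TwoTensor I M) (x : M) (u v : TangentSpace I x) :
    ricciTensor I g x u v = localRicci (chartTensor I g x) (extChartAt I x x) u v := by
  have h := mfderiv_extChartAt_self (I := I) (x := x)
  exact congrArg (fun T : E →L[ℝ] E => localRicci (chartTensor I g x) (extChartAt I x x)
    (T u) (T v)) h

theorem lieDerivativeTensor_eq_localLieDerivative (ζ : ∀ x : M, TangentSpace I x)
    (g : TwoTensor I M) (x : M) (u v : TangentSpace I x) :
    lieDerivativeTensor I ζ g x u v =
      localLieDerivative (chartTensor I g x) (chartVectorField I ζ x) (extChartAt I x x) u v := by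
  have h := mfderiv_extChartAt_self (I := I) (x := x)
  exact congrArg (fun T : E →L[ℝ] E => localLieDerivative (chartTensor I g x)
    (chartVectorField I ζ x) (extChartAt I x x) (T u) (T v)) h

variable [I.Boundaryless]

theorem mdifferentiableAt_extChartAt_symm (x₀ : M) {y : E} (hy : y ∈ (extChartAt I x₀).target) :
    MDifferentiableAt 𝓘(ℝ, E) I (extChartAt I x₀).symm y := by
  have h := mdifferentiableWithinAt_extChartAt_symm (I := I) hy
  rwa [I.range_eq_univ, mdifferentiableWithinAt_univ] at h

theorem mfderiv_extChartAt_symm_inverse {x₀ x : M} (hx : x ∈ (extChartAt I x₀).source) :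
    (mfderiv 𝓘(ℝ, E) I (extChartAt I x₀).symm (extChartAt I x₀ x)).inverse =
      mfderiv I 𝓘(ℝ, E) (extChartAt I x₀) x := by
  have h1 := mfderiv_extChartAt_comp_mfderivWithin_extChartAt_symm' (I := I) hx
  have h2 := mfderivWithin_extChartAt_symm_comp_mfderiv_extChartAt' (I := I) hx
  rw [I.range_eq_univ, mfderivWithin_univ] at h1 h2
  exact ContinuousLinearMap.inverse_eq h2 h1

/-- The tangent bundle trivialization at `x₀` is the derivative of the chart there, so the bundle
coordinates of the section are its chart components. -/
theorem contMDiffAt_twoTensor_iff {n : ℕ∞} (g : TwoTensor I M) (x₀ : M) :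
    ContMDiffAt I (I.prod 𝓘(ℝ, E →L[ℝ] E →L[ℝ] ℝ)) n
      (fun x => Bundle.TotalSpace.mk' (E →L[ℝ] E →L[ℝ] ℝ)
        (E := fun x : M => TangentSpace I x →L[ℝ] TangentSpace I x →L[ℝ] ℝ) x (g x)) x₀ ↔
    ContMDiffAt I 𝓘(ℝ, E →L[ℝ] E →L[ℝ] ℝ) n
      (fun x => chartTensor I g x₀ (extChartAt I x₀ x)) x₀ := by
  rw [Bundle.contMDiffAt_section]
  refine EventuallyEq.contMDiffAt_iff ?_
  filter_upwards [extChartAt_source_mem_nhds (I := I) x₀] with x hx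
  have hx' : x ∈ (chartAt H x₀).source := by rwa [extChartAt_source] at hx
  have hs := TangentBundle.symmL_trivializationAt (I := I) (𝕜 := ℝ) hx'
  rw [I.range_eq_univ, mfderivWithin_univ] at hs
  rw [hom_trivializationAt_apply]
  refine ContinuousLinearMap.ext fun u => ContinuousLinearMap.ext fun v => ?_
  rw [inCoordinates_apply_eq₂ (by simpa using hx') (by simpa using hx') (by simp)]
  -- The pullback evaluates `g` at the image of `x` under the chart and back, which equals `x` only
  -- propositionally; all fibres being `E`, the vectors need no transport.
  have key : ∀ (x' : M) (a b : E), x' = x →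
      g x (show TangentSpace I x from a) (show TangentSpace I x from b) =
        g x' (show TangentSpace I x' from a) (show TangentSpace I x' from b) := by
    rintro _ a b rfl
    rfl
  have hb : x ∈ (trivializationAt E (TangentSpace I) x₀).baseSet := by simpa using hx'
  have hsymm : ∀ w : E, ((trivializationAt E (TangentSpace I) x₀).symm x w : E) =
      mfderiv 𝓘(ℝ, E) I (extChartAt I x₀).symm (extChartAt I x₀ x) w :=
    fun w => (Bundle.Trivialization.symmL_apply (R := ℝ) _ hb w).symm.trans
      (congrArg (fun T : E →L[ℝ] E => T w) hs)
  refine Eq.trans ?_ (key _ _ _ ((extChartAt I x₀).left_inv hx))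
  have ht : (trivializationAt ℝ (fun _ : M => ℝ) x₀).linearMapAt ℝ x = LinearMap.id :=
    Bundle.Trivial.linearMapAt_trivialization ℝ M ℝ x
  refine Eq.trans (congrArg (fun T : ℝ →ₗ[ℝ] ℝ => T _) ht) ?_
  exact congrArg₂ (fun a b : E => g x a b) (hsymm u) (hsymm v)

theorem contMDiffAt_vectorField_iff {n : ℕ∞} (ζ : ∀ x : M, TangentSpace I x) (x₀ : M) :
    ContMDiffAt I I.tangent n (fun x => (⟨x, ζ x⟩ : TangentBundle I M)) x₀ ↔
    ContMDiffAt I 𝓘(ℝ, E) n (fun x => chartVectorField I ζ x₀ (extChartAt I x₀ x)) x₀ := by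
  rw [ModelWithCorners.tangent]
  refine (Bundle.contMDiffAt_section (F := E) (E := fun x : M => TangentSpace I x) x₀).trans ?_
  refine EventuallyEq.contMDiffAt_iff ?_
  filter_upwards [extChartAt_source_mem_nhds (I := I) x₀] with x hx
  have hx' : x ∈ (chartAt H x₀).source := by rwa [extChartAt_source] at hx
  have hs := TangentBundle.continuousLinearMapAt_trivializationAt (I := I) (𝕜 := ℝ) hx'
  rw [chartVectorField, VectorField.mpullback_apply, mfderiv_extChartAt_symm_inverse hx,
    (extChartAt I x₀).left_inv hx, ← hs]
  have hb : x ∈ (trivializationAt E (TangentSpace I) x₀).baseSet := by simpa using hx'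
  exact (congrFun (Bundle.Trivialization.coe_linearMapAt_of_mem (R := ℝ) _ hb) (ζ x)).symm

theorem differentiableAt_chartVectorField {ζ : ∀ x : M, TangentSpace I x}
    (hζ : IsSmoothVectorField I ζ) (x₀ : M) :
    DifferentiableAt ℝ (chartVectorField I ζ x₀) (extChartAt I x₀ x₀) := by
  have h1 := ((contMDiffAt_vectorField_iff ζ x₀).1 (hζ x₀)).mdifferentiableAt (by simp)
  have hx := mem_extChartAt_target (I := I) x₀
  have h2 : MDifferentiableAt 𝓘(ℝ, E) 𝓘(ℝ, E)
      ((fun x => chartVectorField I ζ x₀ (extChartAt I x₀ x)) ∘ (extChartAt I x₀).symm)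
      (extChartAt I x₀ x₀) := by
    refine MDifferentiableAt.comp _ ?_ (mdifferentiableAt_extChartAt_symm x₀ hx)
    rwa [extChartAt_to_inv]
  rw [mdifferentiableAt_iff_differentiableAt] at h2
  refine h2.congr_of_eventuallyEq ?_
  filter_upwards [extChartAt_target_mem_nhds (I := I) x₀] with y hy
  rw [Function.comp_apply, (extChartAt I x₀).right_inv hy]

end ChartComponents

/-! ### The space-time in product charts. -/

section SpaceTimeChart

open Filter Topology TopologicalSpace

variable {J : Opens ℝ}

/-- The chart of `J` is the inclusion into `ℝ`, so this is the chain rule for `val ∘ symm = id`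
together with `dt = id`. -/
theorem mfderiv_extChartAt_symm_opens (t₀ : J) {s : ℝ}
    (hs : s ∈ (extChartAt 𝓘(ℝ, ℝ) t₀).target) :
    mfderiv 𝓘(ℝ, ℝ) 𝓘(ℝ, ℝ) (extChartAt 𝓘(ℝ, ℝ) t₀).symm s = ContinuousLinearMap.id ℝ ℝ := by
  have hd := mdifferentiableAt_extChartAt_symm t₀ hs
  have hv : MDifferentiableAt 𝓘(ℝ, ℝ) 𝓘(ℝ, ℝ) (Subtype.val : J → ℝ)
      ((extChartAt 𝓘(ℝ, ℝ) t₀).symm s) :=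
    (contMDiff_subtype_val (n := 1)).mdifferentiable (by simp) _
  have hcomp := mfderiv_comp s hv hd
  have heq : (Subtype.val : J → ℝ) ∘ (extChartAt 𝓘(ℝ, ℝ) t₀).symm =ᶠ[𝓝 s] id := by
    filter_upwards [extChartAt_target_mem_nhds' hs] with y hy
    exact (extChartAt 𝓘(ℝ, ℝ) t₀).right_inv hy
  rw [heq.mfderiv_eq, mfderiv_id] at hcomp
  have hdt := dt_eq_id ((extChartAt 𝓘(ℝ, ℝ) t₀).symm s)
  rw [dt] at hdt
  rw [hdt] at hcomp
  exact hcomp.symm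

variable {E : Type*} [NormedAddCommGroup E] [NormedSpace ℝ E]
  {H : Type*} [TopologicalSpace H] {I : ModelWithCorners ℝ E H}
  {M : Type*} [TopologicalSpace M] [ChartedSpace H M]

theorem spaceTimeMetric_one_apply {f : M → ℝ} {σ : J → ℝ} (hf : ∀ x, f x = 1)
    (hσ : ∀ t, σ t = 1) (g : TwoTensor I M) (p : J × M)
    (u v : TangentSpace (𝓘(ℝ, ℝ).prod I) p) :
    spaceTimeMetric I f σ g p u v = -((u.1 : ℝ) * (v.1 : ℝ)) + g p.2 u.2 v.2 := by
  have h := spaceTimeMetric_apply I f σ g p u.1 v.1 u.2 v.2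
  have e : ∀ a : ℝ, a • partialT p.1 = a := fun a => mul_one a
  rw [e, e, hf, hσ] at h
  refine h.trans ?_
  ring

variable [I.Boundaryless] [IsManifold I 1 M]

theorem mfderiv_extChartAt_symm_spaceTime (p : J × M) {z : ℝ × E}
    (hz : z ∈ (extChartAt (𝓘(ℝ, ℝ).prod I) p).target) :
    mfderiv 𝓘(ℝ, ℝ × E) (𝓘(ℝ, ℝ).prod I) (extChartAt (𝓘(ℝ, ℝ).prod I) p).symm z =
      (ContinuousLinearMap.id ℝ ℝ).prodMap
        (mfderiv 𝓘(ℝ, E) I (extChartAt I p.2).symm z.2) := by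
  rw [extChartAt_prod] at hz ⊢
  have h1 := mfderiv_extChartAt_symm_opens p.1 hz.1
  have h := mfderiv_prodMap (p := z) (mdifferentiableAt_extChartAt_symm p.1 hz.1)
    (mdifferentiableAt_extChartAt_symm (I := I) p.2 hz.2)
  -- Identifies the product of the models `ℝ` and `E` with the model `ℝ × E`.
  rw [h1, ← modelWithCornersSelf_prod, chartedSpaceSelf_prod] at h
  exact h

theorem chartTensor_spaceTimeMetric {f : M → ℝ} {σ : J → ℝ} (hf : ∀ x, f x = 1)
    (hσ : ∀ t, σ t = 1) (g : TwoTensor I M) (p : J × M) {z : ℝ × E}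
    (hz : z ∈ (extChartAt (𝓘(ℝ, ℝ).prod I) p).target) :
    chartTensor (𝓘(ℝ, ℝ).prod I) (spaceTimeMetric I f σ g) p z =
      lorentzForm (chartTensor I g p.2 z.2) := by
  refine ContinuousLinearMap.ext fun u => ContinuousLinearMap.ext fun v => ?_
  refine (spaceTimeMetric_one_apply hf hσ g _ _ _).trans ?_
  rw [mfderiv_extChartAt_symm_spaceTime p hz, lorentzForm_apply, extChartAt_prod]
  rfl

theorem chartVectorField_liftedField (h : J → ℝ) (ζ : ∀ x : M, TangentSpace I x) (p : J × M)
    {z : ℝ × E} (hz : z ∈ (extChartAt (𝓘(ℝ, ℝ).prod I) p).target) :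
    chartVectorField (𝓘(ℝ, ℝ).prod I) (liftedField I h ζ) p z =
      (h ((extChartAt 𝓘(ℝ, ℝ) p.1).symm z.1), chartVectorField I ζ p.2 z.2) := by
  have hz2 : z.2 ∈ (extChartAt I p.2).target := by rw [extChartAt_prod] at hz; exact hz.2
  have hinv := isInvertible_mfderivWithin_extChartAt_symm hz2
  rw [I.range_eq_univ, mfderivWithin_univ] at hinv
  rw [chartVectorField, VectorField.mpullback_apply, mfderiv_extChartAt_symm_spaceTime p hz]
  obtain ⟨e, he⟩ := hinv
  rw [chartVectorField, VectorField.mpullback_apply, ← he, ContinuousLinearMap.inverse_equiv]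
  have hi := ContinuousLinearMap.inverse_equiv ((ContinuousLinearEquiv.refl ℝ ℝ).prodCongr e)
  refine (congrArg (fun T : ℝ × E →L[ℝ] ℝ × E => T _) hi).trans ?_
  rw [extChartAt_prod]
  refine Prod.ext (mul_one _) rfl

theorem isPseudoRiemannianMetric_spaceTimeMetric {f : M → ℝ} {σ : J → ℝ}
    (hf : ∀ x, f x = 1) (hσ : ∀ t, σ t = 1) {g : TwoTensor I M}
    (hg : IsPseudoRiemannianMetric I g) :
    IsPseudoRiemannianMetric (𝓘(ℝ, ℝ).prod I) (spaceTimeMetric I f σ g) where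
  symm p u v := by
    rw [spaceTimeMetric_one_apply hf hσ, spaceTimeMetric_one_apply hf hσ]
    exact congrArg₂ (fun a b : ℝ => -a + b) (mul_comm _ _) (hg.symm p.2 _ _)
  nondegenerate p u hu := by
    refine Prod.ext ?_ (hg.nondegenerate p.2 u.2 fun v => ?_)
    · have h := (spaceTimeMetric_one_apply hf hσ g p u ((1 : ℝ), (0 : E))).symm.trans (hu _)
      have h0 : g p.2 u.2 (0 : TangentSpace I p.2) = 0 := map_zero _
      have h' : -((u.1 : ℝ) * 1) + g p.2 u.2 (0 : TangentSpace I p.2) = 0 := h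
      rw [h0] at h'
      change (u.1 : ℝ) = 0
      linarith
    · have h := (spaceTimeMetric_one_apply hf hσ g p u ((0 : ℝ), v)).symm.trans (hu _)
      have h' : -((u.1 : ℝ) * 0) + g p.2 u.2 v = 0 := h
      linarith
  smooth := by
    intro p
    rw [contMDiffAt_twoTensor_iff]
    have h1 := (contMDiffAt_twoTensor_iff g p.2).1 (hg.smooth p.2)
    have h2 : ContMDiffAt (𝓘(ℝ, ℝ).prod I) 𝓘(ℝ, E →L[ℝ] E →L[ℝ] ℝ) ∞
        (fun q : J × M => chartTensor I g p.2 (extChartAt I p.2 q.2)) p :=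
      ContMDiffAt.comp (f := Prod.snd) p h1 contMDiffAt_snd
    -- `lorentzForm` is affine: a constant plus a continuous linear map.
    have h3 : ContDiff ℝ ∞ (lorentzForm (E := E)) :=
      contDiff_const.add (ContinuousLinearMap.contDiff _)
    refine (h3.contMDiff.contMDiffAt.comp p h2).congr_of_eventuallyEq ?_
    filter_upwards [extChartAt_source_mem_nhds (I := 𝓘(ℝ, ℝ).prod I) p] with q hq
    rw [chartTensor_spaceTimeMetric hf hσ g p ((extChartAt _ p).map_source hq), extChartAt_prod]
    rfl

theorem isSmoothVectorField_liftedField {h : J → ℝ}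
    (hh : ContMDiff 𝓘(ℝ, ℝ) 𝓘(ℝ, ℝ) ∞ h) {ζ : ∀ x : M, TangentSpace I x}
    (hζ : IsSmoothVectorField I ζ) :
    IsSmoothVectorField (𝓘(ℝ, ℝ).prod I) (liftedField I h ζ) := by
  intro p
  rw [contMDiffAt_vectorField_iff]
  have h1 := (contMDiffAt_vectorField_iff ζ p.2).1 (hζ p.2)
  have h2 : ContMDiffAt (𝓘(ℝ, ℝ).prod I) 𝓘(ℝ, E) ∞
      (fun q : J × M => chartVectorField I ζ p.2 (extChartAt I p.2 q.2)) p :=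
    ContMDiffAt.comp (f := Prod.snd) p h1 contMDiffAt_snd
  have h3 : ContMDiffAt (𝓘(ℝ, ℝ).prod I) 𝓘(ℝ, ℝ) ∞ (fun q : J × M => h q.1) p :=
    ContMDiffAt.comp (f := Prod.fst) p (hh p.1) contMDiffAt_fst
  refine (h3.prodMk_space h2).congr_of_eventuallyEq ?_
  filter_upwards [extChartAt_source_mem_nhds (I := 𝓘(ℝ, ℝ).prod I) p] with q hq
  rw [chartVectorField_liftedField h ζ p ((extChartAt _ p).map_source hq)]
  rw [extChartAt_prod] at hq ⊢
  refine Prod.ext ?_ rfl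
  exact congrArg h ((extChartAt 𝓘(ℝ, ℝ) p.1).left_inv hq.1)

theorem hasDerivAt_comp_extChartAt_symm {h : J → ℝ}
    (hh : MDifferentiable 𝓘(ℝ, ℝ) 𝓘(ℝ, ℝ) h) (t : J) :
    HasDerivAt (fun s : ℝ => h ((extChartAt 𝓘(ℝ, ℝ) t).symm s)) (timeDeriv h t)
      (extChartAt 𝓘(ℝ, ℝ) t t) := by
  have ht := mem_extChartAt_target (I := 𝓘(ℝ, ℝ)) t
  have hc := HasMFDerivAt.comp (extChartAt 𝓘(ℝ, ℝ) t t) (hh _).hasMFDerivAt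
    (mdifferentiableAt_extChartAt_symm t ht).hasMFDerivAt
  rw [mfderiv_extChartAt_symm_opens t ht, extChartAt_to_inv] at hc
  let D : ℝ →L[ℝ] ℝ := mfderiv 𝓘(ℝ, ℝ) 𝓘(ℝ, ℝ) h t
  have hc' : HasFDerivAt (fun s : ℝ => h ((extChartAt 𝓘(ℝ, ℝ) t).symm s)) D
    (extChartAt 𝓘(ℝ, ℝ) t t) := hasMFDerivAt_iff_hasFDerivAt.1 hc
  exact hc'.hasDerivAt

theorem ricciTensor_spaceTimeMetric [FiniteDimensional ℝ E] {f : M → ℝ} {σ : J → ℝ}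
    (hf : ∀ x, f x = 1) (hσ : ∀ t, σ t = 1) (g : TwoTensor I M) (p : J × M)
    (u v : TangentSpace (𝓘(ℝ, ℝ).prod I) p) :
    ricciTensor (𝓘(ℝ, ℝ).prod I) (spaceTimeMetric I f σ g) p u v =
      ricciTensor I g p.2 u.2 v.2 := by
  have hg : chartTensor (𝓘(ℝ, ℝ).prod I) (spaceTimeMetric I f σ g) p
      =ᶠ[𝓝 (extChartAt (𝓘(ℝ, ℝ).prod I) p p)]
        fun z : ℝ × E => lorentzForm (chartTensor I g p.2 z.2) := by
    filter_upwards [extChartAt_target_mem_nhds (I := 𝓘(ℝ, ℝ).prod I) p] with z hz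
    exact chartTensor_spaceTimeMetric hf hσ g p hz
  refine (ricciTensor_eq_localRicci _ p u v).trans ?_
  refine ((localRicci_congr hg u v).trans (localRicci_lorentzForm _ _ u v)).trans ?_
  refine Eq.trans ?_ (ricciTensor_eq_localRicci g p.2 u.2 v.2).symm
  rw [extChartAt_prod]
  rfl

theorem lieDerivativeTensor_spaceTimeMetric {f : M → ℝ} {σ : J → ℝ}
    (hf : ∀ x, f x = 1) (hσ : ∀ t, σ t = 1) (g : TwoTensor I M) {h : J → ℝ}
    (hh : MDifferentiable 𝓘(ℝ, ℝ) 𝓘(ℝ, ℝ) h) {ζ : ∀ x : M, TangentSpace I x}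
    (hζ : IsSmoothVectorField I ζ) (p : J × M) (u v : TangentSpace (𝓘(ℝ, ℝ).prod I) p) :
    lieDerivativeTensor (𝓘(ℝ, ℝ).prod I) (liftedField I h ζ) (spaceTimeMetric I f σ g) p u v =
      -(2 * timeDeriv h p.1 * (u.1 : ℝ) * (v.1 : ℝ)) +
        lieDerivativeTensor I ζ g p.2 u.2 v.2 := by
  have hg : chartTensor (𝓘(ℝ, ℝ).prod I) (spaceTimeMetric I f σ g) p
      =ᶠ[𝓝 (extChartAt (𝓘(ℝ, ℝ).prod I) p p)]
        fun z : ℝ × E => lorentzForm (chartTensor I g p.2 z.2) := by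
    filter_upwards [extChartAt_target_mem_nhds (I := 𝓘(ℝ, ℝ).prod I) p] with z hz
    exact chartTensor_spaceTimeMetric hf hσ g p hz
  have hZ : chartVectorField (𝓘(ℝ, ℝ).prod I) (liftedField I h ζ) p
      =ᶠ[𝓝 (extChartAt (𝓘(ℝ, ℝ).prod I) p p)] fun z : ℝ × E =>
        (h ((extChartAt 𝓘(ℝ, ℝ) p.1).symm z.1), chartVectorField I ζ p.2 z.2) := by
    filter_upwards [extChartAt_target_mem_nhds (I := 𝓘(ℝ, ℝ).prod I) p] with z hz
    exact chartVectorField_liftedField h ζ p hz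
  have hd := hasDerivAt_comp_extChartAt_symm hh p.1
  have he : extChartAt (𝓘(ℝ, ℝ).prod I) p p =
      (extChartAt 𝓘(ℝ, ℝ) p.1 p.1, extChartAt I p.2 p.2) := by
    rw [extChartAt_prod]
    rfl
  have hl := localLieDerivative_lorentzForm (chartTensor I g p.2) (chartVectorField I ζ p.2)
    (fun s : ℝ => h ((extChartAt 𝓘(ℝ, ℝ) p.1).symm s))
    (extChartAt 𝓘(ℝ, ℝ) p.1 p.1, extChartAt I p.2 p.2) u v
    (differentiableAt_chartVectorField hζ p.2) hd.differentiableAt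
  refine (lieDerivativeTensor_eq_localLieDerivative _ _ p u v).trans ?_
  refine (localLieDerivative_congr hg hZ u v).trans ?_
  rw [he]
  refine hl.trans ?_
  rw [hd.deriv]
  exact congrArg (fun a : ℝ => _ + a)
    (lieDerivativeTensor_eq_localLieDerivative ζ g p.2 u.2 v.2).symm

end SpaceTimeChart

theorem mainTheorem8
    {E : Type*} [NormedAddCommGroup E] [NormedSpace ℝ E] [FiniteDimensional ℝ E]
    {H : Type*} [TopologicalSpace H] (I : ModelWithCorners ℝ E H) [I.Boundaryless]
    {M : Type*} [TopologicalSpace M] [ChartedSpace H M] [IsManifold I ∞ M]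
    (g : Bundle.ContMDiffRiemannianMetric I ∞ E (fun x : M => TangentSpace I x))
    (ζ : ∀ x : M, TangentSpace I x)
    (J : TopologicalSpace.Opens ℝ) (hJ : (J : Set ℝ).OrdConnected)
    (f : M → ℝ) (σ : J → ℝ) (hf : ∀ x, f x = 1) (hσ : ∀ t, σ t = 1)
    (h : J → ℝ) (hh : ContMDiff 𝓘(ℝ, ℝ) 𝓘(ℝ, ℝ) ∞ h)
    (c : ℝ) (hc : ∀ t, timeDeriv h t = c)
    (hM : IsRicciSoliton I g.inner ζ c) :
    IsRicciSoliton (𝓘(ℝ, ℝ).prod I) (spaceTimeMetric I f σ g.inner) (liftedField I h ζ) c := by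
  have : IsManifold I 1 M := IsManifold.of_le (n := ∞) (by simp)
  refine ⟨isPseudoRiemannianMetric_spaceTimeMetric hf hσ hM.metric,
    isSmoothVectorField_liftedField hh hM.field, fun p u v => ?_⟩
  have hM' := hM.equation p.2 u.2 v.2
  rw [lieDerivativeTensor_spaceTimeMetric hf hσ _ (hh.mdifferentiable (by simp)) hM.field,
    ricciTensor_spaceTimeMetric hf hσ, spaceTimeMetric_one_apply hf hσ, hc]
  -- The time parts cancel because `½ (-2c u₁ v₁) = c (-u₁ v₁)`; the soliton equation on `M`
  -- remains.
  linear_combination hM'
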